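/- Let $\phi:[0,\infty)\to\mathbb{R}$ and let $y_0\ge 0$ be such that $\phi$ is square-integrable on $[0,y_0]$. Suppose that there are a non-decreasing sequence $(\lambda_n)_{n\in\mathbb{N}}$ of positive real numbers tending to infinity, a sequence $(r_n)_{n\in\mathbb{N}}$ of complex numbers, a real constant $c$, a number $X_0>0$ and a real-valued function $\mathcal{E}(y,X)$ such that $$\phi(y)=c+\Re\Big(\sum_{\lambda_n\le X}r_ne^{i\lambda_ny}\Big)+\mathcal{E}(y,X)\qquad\text{for all } y\ge y_0 \text{ and all } X\ge X_0,$$ where, for all sufficiently large $Y$, the function $y\mapsto\mathcal{E}(y,e^Y)$ is (measurable and) square-integrable on $[y_0,Y]$, and $$\lim_{Y\to\infty}\frac1Y\int_{y_0}^{Y}|\mathcal{E}(y,e^Y)|^2\,dy=0.$$ Let $\alpha,\beta>0$ and $\gamma\ge0$, and assume that at least one of the following two conditions holds, where the implied constants are independent of $S$ and $T$. (a) $\beta>1/2$, and for all sufficiently large $T$, $$\sum_{T<\lambda_n\le T+1}|r_n|\ll\frac{(\log T)^\gamma}{T^\beta}.$$ (b) $\beta\le\min\{1,\alpha\}$, $\alpha^2+\alpha/2<\beta^2+\beta$,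 and for all sufficiently large $S$ and all $T\ge S+1$, $$\sum_{S<\lambda_n\le T}|r_n|\ll\frac{(T-S)^\alpha(\log T)^\gamma}{S^\beta}.$$ Then $\phi$ is a $B^2$-almost periodic function: it is locally square-integrable on $[0,\infty)$, and for every $\varepsilon>0$ there is a real-valued trigonometric polynomial $P(y)=\sum_{n=1}^{N}a_ne^{i\theta_ny}$ (with $a_n\in\mathbb{C}$, $\theta_n\in\mathbb{R}$) such that $$\limsup_{Y\to\infty}\frac1Y\int_0^Y|\phi(y)-P(y)|^2\,dy<\varepsilon^2.$$ Moreover, $\phi$ possesses a limiting distribution: there is a probability measure $\mu$ on $\mathbb{R}$ such that $$\lim_{Y\to\infty}\frac1Y\int_0^Yf(\phi(y))\,dy=\int_{\mathbb{R}}f\,d\mu$$ for every bounded continuous function $f:\mathbb{R}\to\mathbb{R}$. -/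

import Mathlib

open Filter Topology MeasureTheory
open scoped ENNReal BoundedContinuousFunction

noncomputable section

/-- The partial sum `∑_{λ_n ≤ X} r_n e^{i λ_n y}`. It has only finitely many terms
whenever `λ_n → ∞`. -/
def exponentialSum (lam : ℕ → ℝ) (r : ℕ → ℂ) (X y : ℝ) : ℂ :=
  ∑ᶠ (n : ℕ) (_ : lam n ≤ X), r n * Complex.exp (Complex.I * (lam n : ℂ) * (y : ℂ))

/-- The sum `∑_{S < λ_n ≤ T} |r_n|`. It has only finitely many terms whenever `λ_n → ∞`. -/
def coeffSum (lam : ℕ → ℝ) (r : ℕ → ℂ) (S T : ℝ) : ℝ :=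
  ∑ᶠ (n : ℕ) (_ : S < lam n ∧ lam n ≤ T), ‖r n‖

/-- `∑_{T < λ_n ≤ T+1} |r_n| ≪ (log T)^γ / T^β` for all sufficiently large `T`. -/
def ShortIntervalBound (lam : ℕ → ℝ) (r : ℕ → ℂ) (β γ : ℝ) : Prop :=
  ∃ C T₀ : ℝ, ∀ T : ℝ, T₀ ≤ T →
    coeffSum lam r T (T + 1) ≤ C * (Real.log T ^ γ / T ^ β)

/-- `∑_{S < λ_n ≤ T} |r_n| ≪ (T - S)^α (log T)^γ / S^β` for all sufficiently large `S`
and all `T ≥ S + 1`. (Intervals shorter than `1` have to be left out: letting `S` tend to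
`T = λ_n` from below, the bound would force `r_n = 0`.) -/
def LongIntervalBound (lam : ℕ → ℝ) (r : ℕ → ℂ) (α β γ : ℝ) : Prop :=
  ∃ C S₀ : ℝ, ∀ S T : ℝ, S₀ ≤ S → S + 1 ≤ T →
    coeffSum lam r S T ≤ C * ((T - S) ^ α * Real.log T ^ γ / S ^ β)

/-- `P` is a real-valued trigonometric polynomial `P(y) = ∑_{n=1}^N r_n e^{i λ_n y}`
with `r_n ∈ ℂ` and `λ_n ∈ ℝ`. -/
def IsRealTrigPolynomial (P : ℝ → ℝ) : Prop :=
  ∃ (N : ℕ) (r : Fin N → ℂ) (lam : Fin N → ℝ), ∀ y : ℝ,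
    (P y : ℂ) = ∑ n, r n * Complex.exp (Complex.I * (lam n : ℂ) * (y : ℂ))

/-- The upper mean square `limsup_{Y → ∞} (1/Y) ∫_0^Y |f(y)|² dy`, as an element of `[0, ∞]`. -/
def upperMeanSquare (f : ℝ → ℝ) : ℝ≥0∞ :=
  limsup (fun Y : ℝ => (ENNReal.ofReal Y)⁻¹ * ∫⁻ y in Set.Ioc 0 Y, ‖f y‖ₑ ^ 2) atTop

/-- `B²`-almost periodicity of a function on `[0, ∞)` (values at negative arguments are
irrelevant): `φ` is locally square-integrable on `[0, ∞)`, and for every `ε > 0` there is a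
real-valued trigonometric polynomial `P` with
`limsup_{Y → ∞} (1/Y) ∫_0^Y |φ - P|² < ε²`. -/
def IsB2AlmostPeriodic (φ : ℝ → ℝ) : Prop :=
  (∀ Y : ℝ, 0 < Y → MemLp φ 2 (volume.restrict (Set.Ioc 0 Y))) ∧
  ∀ ε : ℝ, 0 < ε → ∃ P : ℝ → ℝ, IsRealTrigPolynomial P ∧
    upperMeanSquare (fun y => φ y - P y) < ENNReal.ofReal (ε ^ 2)

/-- The probability measure `μ` on `ℝ` is the limiting distribution of `φ` (a function on
`[0, ∞)`; values at negative arguments are irrelevant): for every bounded continuous real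
function `f` on `ℝ`, `(1/Y) ∫_0^Y f(φ(y)) dy → ∫ f dμ` as `Y → ∞`. The integrals on the left
are required to make sense. -/
def HasLimitingDistribution (φ : ℝ → ℝ) (μ : Measure ℝ) : Prop :=
  IsProbabilityMeasure μ ∧
  ∀ f : ℝ →ᵇ ℝ,
    (∀ Y : ℝ, 0 < Y → IntegrableOn (fun y => f (φ y)) (Set.Ioc 0 Y) volume) ∧
    Tendsto (fun Y : ℝ => Y⁻¹ * ∫ y in Set.Ioc 0 Y, f (φ y)) atTop (𝓝 (∫ x, f x ∂μ))

end

/-!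
The proof has three parts.

*Square-summability.* Write `B_j` for the sum of `|r_n|` over `j < λ_n ≤ j + 1`. Each of the two
conditions on the coefficients implies `∑ B_j² < ∞`. For the short interval bound this is immediate
from `β > 1/2`. For the long interval bound, `α² + α/2 < β² + β` forces `α < 2β`, and on a dyadic
block `[S, 2S)` the sum of the `B_j²` is at most the largest `B_j` times their sum, which is
`≪ S^(α - 2β + ε)`; see `ShortIntervalBound.summable_sq` and `LongIntervalBound.summable_sq`.

*Mean squares.* The indicator function of `(0, Y]` is at most `e · e^{-|y|/Y}`, and the Fourier
transform of `e^{-|y|/Y}` is `2Y / (1 + Y²ξ²)`. So for `Y ≥ 1` the mean square of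
`∑ r_n e^{iλ_n y}` over `(0, Y]` is at most a constant times `∑ |r_m r_n| / (1 + (λ_m - λ_n)²)`,
and Schur's test bounds this by a constant times `∑ B_j²`, uniformly in `Y` and in the number of
terms (`setIntegral_norm_sq_expSum_le_tsum`). Applied to the frequencies in `(N, e^Y]`, this shows
that `c + Re ∑_{λ_n ≤ N} r_n e^{iλ_n y}` approximates `φ` in mean square as `N → ∞`
(`isB2AlmostPeriodic_of_summable_sq`).

*Limiting distribution.* For a trigonometric polynomial `P` and a continuous `F`, the mean of
`F ∘ P` exists by Weierstrass approximation. If `F` is bounded and Lipschitz, approximating `φ` by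
`P` in mean square shows that the mean of `F ∘ φ` exists. The distributions of `φ` on `(0, Y]` are
tight because the second moments are bounded, so Prokhorov's theorem gives a limit point, which must
be the limit (`IsB2AlmostPeriodic.exists_hasLimitingDistribution`).
-/

/-! ### Real trigonometric polynomials and their means -/

lemma isRealTrigPolynomial_of_fintype {ι : Type*} [Fintype ι] {P : ℝ → ℝ} (r : ι → ℂ)
    (lam : ι → ℝ)
    (hP : ∀ y : ℝ, (P y : ℂ) = ∑ i, r i * Complex.exp (Complex.I * (lam i : ℂ) * (y : ℂ))) :
    IsRealTrigPolynomial P := by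
  let e := Fintype.equivFin ι
  refine ⟨Fintype.card ι, r ∘ e.symm, lam ∘ e.symm, fun y => ?_⟩
  rw [hP y]
  exact (Equiv.sum_comp e.symm
    (fun i => r i * Complex.exp (Complex.I * (lam i : ℂ) * (y : ℂ)))).symm

namespace IsRealTrigPolynomial

lemma const (c : ℝ) : IsRealTrigPolynomial (fun _ => c) :=
  ⟨1, fun _ => c, fun _ => 0, fun y => by simp⟩

lemma add {P Q : ℝ → ℝ} (hP : IsRealTrigPolynomial P) (hQ : IsRealTrigPolynomial Q) :
    IsRealTrigPolynomial (fun y => P y + Q y) := by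
  obtain ⟨N, r, l, h⟩ := hP
  obtain ⟨M, s, m, k⟩ := hQ
  refine isRealTrigPolynomial_of_fintype (ι := Fin N ⊕ Fin M) (Sum.elim r s) (Sum.elim l m)
    fun y => ?_
  simp [h, k]

lemma mul {P Q : ℝ → ℝ} (hP : IsRealTrigPolynomial P) (hQ : IsRealTrigPolynomial Q) :
    IsRealTrigPolynomial (fun y => P y * Q y) := by
  obtain ⟨N, r, l, h⟩ := hP
  obtain ⟨M, s, m, k⟩ := hQ
  refine isRealTrigPolynomial_of_fintype (ι := Fin N × Fin M) (fun i => r i.1 * s i.2)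
    (fun i => l i.1 + m i.2) fun y => ?_
  push_cast
  rw [h, k, Finset.sum_mul_sum, Fintype.sum_prod_type]
  refine Finset.sum_congr rfl fun i _ => Finset.sum_congr rfl fun j _ => ?_
  rw [mul_mul_mul_comm, ← Complex.exp_add]
  ring_nf

lemma re_exp (r : ℂ) (l : ℝ) :
    IsRealTrigPolynomial
      (fun y => (r * Complex.exp (Complex.I * (l : ℂ) * (y : ℂ))).re) := by
  refine ⟨2, ![r / 2, (starRingEnd ℂ) r / 2], ![l, -l], fun y => ?_⟩
  rw [Complex.re_eq_add_conj]
  simp [← Complex.exp_conj]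
  ring

lemma finset_sum {ι : Type*} (s : Finset ι) {P : ι → ℝ → ℝ}
    (hP : ∀ i ∈ s, IsRealTrigPolynomial (P i)) :
    IsRealTrigPolynomial (fun y => ∑ i ∈ s, P i y) := by
  classical
  induction s using Finset.induction_on with
  | empty => simpa using const 0
  | insert a s ha ih =>
    simp only [Finset.sum_insert ha]
    exact (hP a (Finset.mem_insert_self a s)).add
      (ih fun i hi => hP i (Finset.mem_insert_of_mem hi))

lemma polynomial_eval {P : ℝ → ℝ} (hP : IsRealTrigPolynomial P) (q : Polynomial ℝ) :
    IsRealTrigPolynomial (fun y => q.eval (P y)) := by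
  induction q using Polynomial.induction_on' with
  | add p q hp hq => simpa only [Polynomial.eval_add] using hp.add hq
  | monomial n a =>
    simp only [Polynomial.eval_monomial]
    refine (const a).mul ?_
    induction n with
    | zero => simpa using const 1
    | succ n ih => simpa only [pow_succ] using ih.mul hP

lemma continuous {P : ℝ → ℝ} (hP : IsRealTrigPolynomial P) : Continuous P := by
  obtain ⟨N, r, l, h⟩ := hP
  have : P = fun y : ℝ =>
      (∑ n, r n * Complex.exp (Complex.I * (l n : ℂ) * (y : ℂ))).re := by
    funext y
    rw [← h, Complex.ofReal_re]
  rw [this]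
  fun_prop

lemma exists_abs_le {P : ℝ → ℝ} (hP : IsRealTrigPolynomial P) : ∃ A, ∀ y, |P y| ≤ A := by
  obtain ⟨N, r, l, h⟩ := hP
  refine ⟨∑ n, ‖r n‖, fun y => ?_⟩
  rw [← Real.norm_eq_abs, ← Complex.norm_real, h]
  refine (norm_sum_le _ _).trans (le_of_eq ?_)
  refine Finset.sum_congr rfl fun n _ => ?_
  rw [norm_mul, Complex.norm_exp]
  simp

end IsRealTrigPolynomial

/-- The mean value `(1/Y) ∫_0^Y f` of `f` over `(0, Y]`. -/
noncomputable def meanValue (f : ℝ → ℝ) (Y : ℝ) : ℝ :=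
  Y⁻¹ * ∫ y in Set.Ioc 0 Y, f y

lemma meanValue_mono {f g : ℝ → ℝ} {Y : ℝ} (hY : 0 < Y)
    (hf : IntegrableOn f (Set.Ioc 0 Y)) (hg : IntegrableOn g (Set.Ioc 0 Y))
    (h : ∀ y, f y ≤ g y) : meanValue f Y ≤ meanValue g Y :=
  mul_le_mul_of_nonneg_left (integral_mono hf hg h) (inv_nonneg.2 hY.le)

lemma meanValue_const (c : ℝ) {Y : ℝ} (hY : 0 < Y) : meanValue (fun _ => c) Y = c := by
  simp [meanValue, hY.le, hY.ne']

lemma meanValue_add {f g : ℝ → ℝ} {Y : ℝ} (hf : IntegrableOn f (Set.Ioc 0 Y))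
    (hg : IntegrableOn g (Set.Ioc 0 Y)) :
    meanValue (fun y => f y + g y) Y = meanValue f Y + meanValue g Y := by
  rw [meanValue, integral_add hf hg, mul_add, meanValue, meanValue]

lemma meanValue_const_mul (c : ℝ) (f : ℝ → ℝ) (Y : ℝ) :
    meanValue (fun y => c * f y) Y = c * meanValue f Y := by
  rw [meanValue, integral_const_mul, meanValue]
  ring

lemma abs_meanValue_sub_le {f g : ℝ → ℝ} {Y : ℝ} (hY : 0 < Y)
    (hf : IntegrableOn f (Set.Ioc 0 Y)) (hg : IntegrableOn g (Set.Ioc 0 Y)) :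
    |meanValue f Y - meanValue g Y| ≤ meanValue (fun y => |f y - g y|) Y := by
  rw [meanValue, meanValue, ← mul_sub, ← integral_sub hf hg, abs_mul,
    abs_of_pos (inv_pos.2 hY)]
  exact mul_le_mul_of_nonneg_left abs_integral_le_integral_abs (inv_nonneg.2 hY.le)

lemma exists_tendsto_of_forall_approx {a : ℝ → ℝ}
    (h : ∀ ε > 0, ∃ (b : ℝ → ℝ) (l : ℝ), Tendsto b atTop (𝓝 l) ∧
      ∀ᶠ Y in atTop, |a Y - b Y| ≤ ε) :
    ∃ l, Tendsto a atTop (𝓝 l) := by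
  refine cauchySeq_tendsto_of_complete (Metric.cauchySeq_iff.2 fun ε hε => ?_)
  obtain ⟨b, l, hb, hab⟩ := h (ε / 8) (by positivity)
  have hbl : ∀ᶠ Y in atTop, |b Y - l| < ε / 8 := by
    simpa [Real.dist_eq] using (Metric.tendsto_nhds.1 hb) (ε / 8) (by positivity)
  obtain ⟨N, hN⟩ := eventually_atTop.1 (hab.and hbl)
  refine ⟨N, fun m hm n hn => ?_⟩
  obtain ⟨h1, h2⟩ := hN m hm
  obtain ⟨h3, h4⟩ := hN n hn
  rw [Real.dist_eq]
  rw [abs_le] at h1 h3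
  rw [abs_lt] at h2 h4 ⊢
  constructor <;> linarith

lemma tendsto_mean_exp (θ : ℝ) : ∃ l : ℂ, Tendsto (fun Y : ℝ => ((Y⁻¹ : ℝ) : ℂ) *
    ∫ y in Set.Ioc 0 Y, Complex.exp (Complex.I * (θ : ℂ) * (y : ℂ))) atTop (𝓝 l) := by
  rcases eq_or_ne θ 0 with rfl | hθ
  · refine ⟨1, tendsto_const_nhds.congr' ?_⟩
    filter_upwards [eventually_gt_atTop 0] with Y hY
    simp [hY.le, hY.ne']
  · refine ⟨0, ?_⟩
    have hc : Complex.I * (θ : ℂ) ≠ 0 := by simp [hθ]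
    refine squeeze_zero_norm' (a := fun Y : ℝ => Y⁻¹ * (2 / |θ|)) ?_ ?_
    · filter_upwards [eventually_gt_atTop 0] with Y hY
      rw [← intervalIntegral.integral_of_le hY.le, integral_exp_mul_complex hc, norm_mul,
        Complex.norm_real, Real.norm_of_nonneg (inv_nonneg.2 hY.le), norm_div]
      gcongr
      · refine (norm_sub_le _ _).trans ?_
        simp only [Complex.norm_exp]
        simp
        norm_num
      · simp
    · simpa using tendsto_inv_atTop_zero.mul_const (2 / |θ|)

lemma IsRealTrigPolynomial.exists_tendsto_meanValue {P : ℝ → ℝ} (hP : IsRealTrigPolynomial P) :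
    ∃ l, Tendsto (meanValue P) atTop (𝓝 l) := by
  obtain ⟨N, r, lam, h⟩ := hP
  choose l hl using fun n => tendsto_mean_exp (lam n)
  refine ⟨(∑ n, r n * l n).re, ?_⟩
  have key := (Complex.continuous_re.tendsto _).comp
    (tendsto_finsetSum Finset.univ fun n _ => (hl n).const_mul (r n))
  refine key.congr fun Y => ?_
  have hI : ((∫ y in Set.Ioc 0 Y, P y : ℝ) : ℂ) = ∑ n, r n *
      ∫ y in Set.Ioc 0 Y, Complex.exp (Complex.I * (lam n : ℂ) * (y : ℂ)) := by
    rw [← integral_complex_ofReal]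
    simp_rw [h]
    rw [integral_finsetSum]
    · simp_rw [integral_const_mul]
    · intro n _
      exact (Continuous.integrableOn_Ioc (by fun_prop))
  have : ((meanValue P Y : ℝ) : ℂ) = ∑ n, r n * (((Y⁻¹ : ℝ) : ℂ) *
      ∫ y in Set.Ioc 0 Y, Complex.exp (Complex.I * (lam n : ℂ) * (y : ℂ))) := by
    rw [meanValue, Complex.ofReal_mul, hI, Finset.mul_sum]
    exact Finset.sum_congr rfl fun n _ => by ring
  rw [Function.comp_apply, ← this, Complex.ofReal_re]

/-- By the Weierstrass approximation theorem, `F ∘ P` is a uniform limit of trigonometric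
polynomials `q ∘ P` with `q` a polynomial. -/
lemma IsRealTrigPolynomial.exists_tendsto_meanValue_comp {P F : ℝ → ℝ}
    (hP : IsRealTrigPolynomial P) (hF : Continuous F) :
    ∃ l, Tendsto (meanValue fun y => F (P y)) atTop (𝓝 l) := by
  obtain ⟨A, hA⟩ := hP.exists_abs_le
  refine exists_tendsto_of_forall_approx fun ε hε => ?_
  obtain ⟨q, hq⟩ := exists_polynomial_near_of_continuousOn (-A) A F hF.continuousOn ε hε
  obtain ⟨l, hl⟩ := (hP.polynomial_eval q).exists_tendsto_meanValue
  refine ⟨_, l, hl, ?_⟩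
  filter_upwards [eventually_gt_atTop 0] with Y hY
  have c1 : Continuous fun y => F (P y) := hF.comp hP.continuous
  have c2 : Continuous fun y => q.eval (P y) := (hP.polynomial_eval q).continuous
  refine (abs_meanValue_sub_le hY c1.integrableOn_Ioc c2.integrableOn_Ioc).trans ?_
  refine (meanValue_mono hY (c1.sub c2).abs.integrableOn_Ioc
    continuous_const.integrableOn_Ioc fun y => ?_).trans_eq (meanValue_const ε hY)
  rw [Pi.sub_apply, abs_sub_comm]
  exact (hq _ (abs_le.1 (hA y))).le

/-! ### Limiting distributions of `B²`-almost periodic functions -/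

lemma mean_lintegral_eq_ofReal_meanValue {g : ℝ → ℝ} {Y : ℝ} (hY : 0 < Y)
    (hg : MemLp g 2 (volume.restrict (Set.Ioc 0 Y))) :
    (ENNReal.ofReal Y)⁻¹ * ∫⁻ y in Set.Ioc 0 Y, ‖g y‖ₑ ^ 2 =
      ENNReal.ofReal (meanValue (fun y => g y ^ 2) Y) := by
  rw [meanValue, ENNReal.ofReal_mul (inv_nonneg.2 hY.le), ENNReal.ofReal_inv_of_pos hY,
    ofReal_integral_eq_lintegral_ofReal hg.integrable_sq (ae_of_all _ fun y => sq_nonneg _)]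
  congr 1
  refine lintegral_congr fun y => ?_
  rw [Real.enorm_eq_ofReal_abs, ← ENNReal.ofReal_pow (abs_nonneg _), sq_abs]

lemma IsRealTrigPolynomial.memLp {P : ℝ → ℝ} (hP : IsRealTrigPolynomial P) {p : ℝ≥0∞}
    {μ : Measure ℝ} [IsFiniteMeasure μ] : MemLp P p μ := by
  obtain ⟨A, hA⟩ := hP.exists_abs_le
  exact MemLp.of_bound hP.continuous.aestronglyMeasurable A (ae_of_all _ hA)

lemma IsB2AlmostPeriodic.exists_meanValue_sub_sq_le {φ : ℝ → ℝ} (h : IsB2AlmostPeriodic φ)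
    {ε : ℝ} (hε : 0 < ε) : ∃ P, IsRealTrigPolynomial P ∧
      ∀ᶠ Y in atTop, meanValue (fun y => (φ y - P y) ^ 2) Y ≤ ε ^ 2 := by
  obtain ⟨P, hP, hlt⟩ := h.2 ε hε
  refine ⟨P, hP, ?_⟩
  filter_upwards [eventually_lt_of_limsup_lt hlt, eventually_gt_atTop 0] with Y hY hY0
  rw [mean_lintegral_eq_ofReal_meanValue (g := fun y => φ y - P y) hY0
    ((h.1 Y hY0).sub hP.memLp),
    ENNReal.ofReal_lt_ofReal_iff (by positivity)] at hY
  exact hY.le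

lemma IsB2AlmostPeriodic.integrableOn_comp {φ F : ℝ → ℝ} (h : IsB2AlmostPeriodic φ)
    (hF : Continuous F) {C : ℝ} (hC : ∀ x, |F x| ≤ C) {Y : ℝ} (hY : 0 < Y) :
    IntegrableOn (fun y => F (φ y)) (Set.Ioc 0 Y) :=
  Integrable.of_bound (hF.comp_aestronglyMeasurable (h.1 Y hY).1) C
    (ae_of_all _ fun y => hC (φ y))

/-- Means of bounded Lipschitz functions of `φ` exist, since `F ∘ φ` is close in mean to `F ∘ P`
for a trigonometric polynomial `P` close to `φ` in mean square. -/
lemma IsB2AlmostPeriodic.exists_tendsto_meanValue_comp {φ F : ℝ → ℝ}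
    (h : IsB2AlmostPeriodic φ) {L : NNReal} (hF : LipschitzWith L F) {C : ℝ}
    (hC : ∀ x, |F x| ≤ C) :
    ∃ l, Tendsto (meanValue fun y => F (φ y)) atTop (𝓝 l) := by
  refine exists_tendsto_of_forall_approx fun ε hε => ?_
  set δ : ℝ := ε / (L + 1) with hδ
  have hL : (0 : ℝ) < L + 1 := by positivity
  have hδ0 : 0 < δ := by positivity
  obtain ⟨P, hP, hPY⟩ := h.exists_meanValue_sub_sq_le hδ0
  obtain ⟨l, hl⟩ := hP.exists_tendsto_meanValue_comp hF.continuous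
  refine ⟨_, l, hl, ?_⟩
  filter_upwards [hPY, eventually_gt_atTop 0] with Y hY hY0
  have i1 := h.integrableOn_comp hF.continuous hC hY0
  have i2 : IntegrableOn (fun y => F (P y)) (Set.Ioc 0 Y) :=
    (hF.continuous.comp hP.continuous).integrableOn_Ioc
  have i3 : IntegrableOn (fun y => (φ y - P y) ^ 2) (Set.Ioc 0 Y) :=
    ((h.1 Y hY0).sub hP.memLp).integrable_sq
  have i4 : IntegrableOn (fun _ : ℝ => L * (δ / 2)) (Set.Ioc 0 Y) :=
    continuous_const.integrableOn_Ioc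
  have i5 := i3.const_mul (L / (2 * δ))
  refine (abs_meanValue_sub_le hY0 i1 i2).trans ?_
  -- The inequality `|x| ≤ δ / 2 + x² / (2 δ)` replaces the Cauchy-Schwarz inequality.
  refine (meanValue_mono (g := fun y => L * (δ / 2) + L / (2 * δ) * (φ y - P y) ^ 2) hY0
    (i1.sub i2).abs (i4.add i5) fun y => ?_).trans ?_
  · have h1 : |F (φ y) - F (P y)| ≤ L * |φ y - P y| := by
      simpa [Real.dist_eq] using hF.dist_le_mul (φ y) (P y)
    refine h1.trans ?_
    have h2 : |φ y - P y| ≤ δ / 2 + (φ y - P y) ^ 2 / (2 * δ) := by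
      rw [← sq_abs, div_add_div _ _ two_ne_zero (by positivity), le_div_iff₀ (by positivity)]
      nlinarith [sq_nonneg (|φ y - P y| - δ)]
    calc L * |φ y - P y| ≤ L * (δ / 2 + (φ y - P y) ^ 2 / (2 * δ)) := by gcongr
      _ = _ := by ring
  · rw [meanValue_add i4 i5, meanValue_const _ hY0, meanValue_const_mul]
    calc L * (δ / 2) + L / (2 * δ) * meanValue (fun y => (φ y - P y) ^ 2) Y
        ≤ L * (δ / 2) + L / (2 * δ) * δ ^ 2 := by gcongr
      _ = L * δ := by field_simp; ring
      _ ≤ (L + 1) * δ := by gcongr; linarith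
      _ = ε := by rw [hδ]; field_simp

lemma IsB2AlmostPeriodic.exists_meanValue_sq_le {φ : ℝ → ℝ} (h : IsB2AlmostPeriodic φ) :
    ∃ K, ∀ᶠ Y in atTop, meanValue (fun y => φ y ^ 2) Y ≤ K := by
  obtain ⟨P, hP, hPY⟩ := h.exists_meanValue_sub_sq_le one_pos
  obtain ⟨A, hA⟩ := hP.exists_abs_le
  refine ⟨2 * 1 ^ 2 + 2 * A ^ 2, ?_⟩
  filter_upwards [hPY, eventually_gt_atTop 0] with Y hY hY0
  have i3 : IntegrableOn (fun y => (φ y - P y) ^ 2) (Set.Ioc 0 Y) :=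
    ((h.1 Y hY0).sub hP.memLp).integrable_sq
  have i4 : IntegrableOn (fun _ : ℝ => 2 * A ^ 2) (Set.Ioc 0 Y) :=
    continuous_const.integrableOn_Ioc
  have i5 : IntegrableOn (fun y => 2 * (φ y - P y) ^ 2) (Set.Ioc 0 Y) := i3.const_mul 2
  refine (meanValue_mono (g := fun y => 2 * (φ y - P y) ^ 2 + 2 * A ^ 2) hY0
    (h.1 Y hY0).integrable_sq (i5.add i4) fun y => ?_).trans ?_
  · have : P y ^ 2 ≤ A ^ 2 := sq_le_sq' (abs_le.1 (hA y)).1 (abs_le.1 (hA y)).2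
    nlinarith [sq_nonneg (φ y - 2 * P y)]
  · rw [meanValue_add i5 i4, meanValue_const _ hY0, meanValue_const_mul]
    gcongr

/-- The uniform probability measure on `(0, Y]`. -/
noncomputable def uniformMeasure (Y : ℝ) : Measure ℝ :=
  (ENNReal.ofReal Y)⁻¹ • volume.restrict (Set.Ioc 0 Y)

lemma isProbabilityMeasure_uniformMeasure {Y : ℝ} (hY : 0 < Y) :
    IsProbabilityMeasure (uniformMeasure Y) := by
  constructor
  simp only [uniformMeasure, Measure.smul_apply, Measure.restrict_apply_univ, Real.volume_Ioc,
    sub_zero, smul_eq_mul]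
  exact ENNReal.inv_mul_cancel (by simpa using hY) ENNReal.ofReal_ne_top

lemma aemeasurable_uniformMeasure {φ : ℝ → ℝ} {Y : ℝ}
    (h : AEStronglyMeasurable φ (volume.restrict (Set.Ioc 0 Y))) :
    AEMeasurable φ (uniformMeasure Y) :=
  h.aemeasurable.smul_measure _

lemma integral_map_uniformMeasure {φ F : ℝ → ℝ} {Y : ℝ} (hY : 0 < Y)
    (h : AEStronglyMeasurable φ (volume.restrict (Set.Ioc 0 Y))) (hF : Continuous F) :
    ∫ x, F x ∂((uniformMeasure Y).map φ) = meanValue (fun y => F (φ y)) Y := by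
  rw [integral_map (aemeasurable_uniformMeasure h) hF.aestronglyMeasurable, uniformMeasure,
    integral_smul_measure, meanValue, ENNReal.toReal_inv, ENNReal.toReal_ofReal hY.le,
    smul_eq_mul]

/-- Chebyshev's inequality for the distribution of `φ` on `(0, Y]`. -/
lemma map_uniformMeasure_compl_closedBall_le {φ : ℝ → ℝ} {Y R K : ℝ} (hY : 0 < Y) (hR : 0 < R)
    (h : MemLp φ 2 (volume.restrict (Set.Ioc 0 Y)))
    (hK : meanValue (fun y => φ y ^ 2) Y ≤ K) :
    (uniformMeasure Y).map φ (Metric.closedBall 0 R)ᶜ ≤ ENNReal.ofReal (K / R ^ 2) := by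
  have hm := aemeasurable_uniformMeasure h.1
  rw [Measure.map_apply_of_aemeasurable hm Metric.isClosed_closedBall.measurableSet.compl]
  have h1 : uniformMeasure Y {y | ENNReal.ofReal (R ^ 2) ≤ ‖φ y‖ₑ ^ 2} ≤
      (∫⁻ y, ‖φ y‖ₑ ^ 2 ∂(uniformMeasure Y)) / ENNReal.ofReal (R ^ 2) :=
    meas_ge_le_lintegral_div (hm.enorm.pow_const 2) (by simpa using hR.ne') ENNReal.ofReal_ne_top
  rw [uniformMeasure, lintegral_smul_measure, smul_eq_mul,
    mean_lintegral_eq_ofReal_meanValue hY h, ← ENNReal.ofReal_div_of_pos (by positivity)] at h1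
  refine (measure_mono fun y hy => ?_).trans (h1.trans (ENNReal.ofReal_le_ofReal ?_))
  · have hy' : R < |φ y| := by simpa using hy
    show ENNReal.ofReal (R ^ 2) ≤ ‖φ y‖ₑ ^ 2
    rw [Real.enorm_eq_ofReal_abs, ← ENNReal.ofReal_pow (abs_nonneg _)]
    gcongr
  · gcongr

/-- The distributions of `φ` on the intervals `(0, Y]` are tight, so they have a limit point by
Prokhorov's theorem; means of bounded Lipschitz functions of `φ` exist, so this limit point is the
limit. -/
theorem IsB2AlmostPeriodic.exists_hasLimitingDistribution {φ : ℝ → ℝ}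
    (h : IsB2AlmostPeriodic φ) : ∃ μ : Measure ℝ, HasLimitingDistribution φ μ := by
  obtain ⟨K, hK⟩ := h.exists_meanValue_sq_le
  obtain ⟨Y₀, hY₀⟩ := eventually_atTop.1 hK
  -- Small `Y` are replaced by `Y₁`, so that all the distributions are controlled.
  set Y₁ : ℝ := max Y₀ 1 with hY₁
  have hpos (Y : ℝ) : 0 < max Y Y₁ := by
    rw [hY₁]
    exact one_pos.trans_le ((le_max_right _ _).trans (le_max_right _ _))
  have hbd (Y : ℝ) : meanValue (fun y => φ y ^ 2) (max Y Y₁) ≤ K :=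
    hY₀ _ ((le_max_left _ _).trans (le_max_right _ _))
  have hprob (Y : ℝ) : IsProbabilityMeasure ((uniformMeasure (max Y Y₁)).map φ) :=
    haveI := isProbabilityMeasure_uniformMeasure (hpos Y)
    Measure.isProbabilityMeasure_map (aemeasurable_uniformMeasure (h.1 _ (hpos Y)).1)
  let ν : ℝ → ProbabilityMeasure ℝ := fun Y => ⟨_, hprob Y⟩
  have hν {F : ℝ → ℝ} (hF : Continuous F) (Y : ℝ) :
      ∫ x, F x ∂(ν Y : Measure ℝ) = meanValue (fun y => F (φ y)) (max Y Y₁) :=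
    integral_map_uniformMeasure (hpos Y) (h.1 _ (hpos Y)).1 hF
  have hmax : (fun Y => max Y Y₁) =ᶠ[atTop] id := by
    filter_upwards [eventually_ge_atTop Y₁] with Y hY using max_eq_left hY
  have htight : IsTightMeasureSet {((ρ : ProbabilityMeasure ℝ) : Measure ℝ) | ρ ∈ Set.range ν} := by
    rw [isTightMeasureSet_iff_exists_isCompact_measure_compl_le]
    intro ε hε
    have hlim : Tendsto (fun R : ℝ => ENNReal.ofReal (K / R ^ 2)) atTop (𝓝 0) := by
      rw [← ENNReal.ofReal_zero]
      exact ENNReal.tendsto_ofReal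
        (tendsto_const_nhds.div_atTop (tendsto_pow_atTop two_ne_zero))
    obtain ⟨R, hRε, hR⟩ := ((hlim.eventually_le_const hε).and (eventually_gt_atTop 0)).exists
    refine ⟨Metric.closedBall 0 R, isCompact_closedBall 0 R, ?_⟩
    rintro _ ⟨_, ⟨Y, rfl⟩, rfl⟩
    exact (map_uniformMeasure_compl_closedBall_le (hpos Y) hR (h.1 _ (hpos Y)) (hbd Y)).trans hRε
  obtain ⟨μ, -, hμ⟩ := (isCompact_closure_of_isTightMeasureSet htight).ultrafilter_le_nhds
    ((Ultrafilter.of (atTop : Filter ℝ)).map ν)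
    ((le_principal_iff.2 range_mem_map).trans (monotone_principal subset_closure))
  have hμ' : Tendsto ν (Ultrafilter.of (atTop : Filter ℝ)) (𝓝 μ) := hμ
  have hconv : Tendsto ν atTop (𝓝 μ) := by
    rw [tendsto_iff_forall_lipschitz_integral_tendsto]
    rintro F ⟨C, hC⟩ ⟨L, hL⟩
    have hFb (x : ℝ) : |F x| ≤ C + |F 0| := by
      have := abs_sub_abs_le_abs_sub (F x) (F 0)
      have h2 := hC x 0
      rw [Real.dist_eq] at h2
      linarith
    obtain ⟨l, hl⟩ := h.exists_tendsto_meanValue_comp hL hFb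
    have hl' : Tendsto (fun Y => ∫ x, F x ∂(ν Y : Measure ℝ)) atTop (𝓝 l) := by
      refine hl.congr' ?_
      filter_upwards [hmax] with Y hY
      rw [hν hL.continuous, hY, id]
    let F' : ℝ →ᵇ ℝ := ⟨⟨F, hL.continuous⟩, C, hC⟩
    have h2 := (ProbabilityMeasure.tendsto_iff_forall_integral_tendsto.1 hμ') F'
    rwa [tendsto_nhds_unique (hl'.mono_left (Ultrafilter.of_le _)) h2] at hl'
  refine ⟨μ, inferInstance, fun f => ⟨fun Y hY =>
    h.integrableOn_comp f.continuous (fun x => f.norm_coe_le_norm x) hY, ?_⟩⟩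
  refine ((ProbabilityMeasure.tendsto_iff_forall_integral_tendsto.1 hconv) f).congr' ?_
  filter_upwards [hmax] with Y hY
  rw [hν f.continuous, hY, id, meanValue]

/-! ### A large sieve inequality for mean squares of exponential sums -/

lemma integrable_exp_sub_mul_abs {a : ℝ} (ha : 0 < a) (ξ : ℝ) :
    Integrable (fun y : ℝ => Complex.exp (Complex.I * ξ * y - a * (|y| : ℝ))) ∧
      ∫ y : ℝ, Complex.exp (Complex.I * ξ * y - a * (|y| : ℝ)) =
        ((2 * a / (a ^ 2 + ξ ^ 2) : ℝ) : ℂ) := by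
  have hre1 : (Complex.I * ξ - a : ℂ).re < 0 := by simpa using ha
  have hre2 : 0 < (Complex.I * ξ + a : ℂ).re := by simpa using ha
  have e1 : Set.EqOn (fun y : ℝ => Complex.exp ((Complex.I * ξ - a) * y))
      (fun y : ℝ => Complex.exp (Complex.I * ξ * y - a * (|y| : ℝ))) (Set.Ioi 0) := by
    intro y hy
    simp only [abs_of_pos (Set.mem_Ioi.1 hy)]
    ring_nf
  have e2 : Set.EqOn (fun y : ℝ => Complex.exp ((Complex.I * ξ + a) * y))
      (fun y : ℝ => Complex.exp (Complex.I * ξ * y - a * (|y| : ℝ))) (Set.Iic 0) := by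
    intro y hy
    simp only [abs_of_nonpos (Set.mem_Iic.1 hy)]
    push_cast
    ring_nf
  have i1 := (integrableOn_exp_mul_complex_Ioi hre1 0).congr_fun e1 measurableSet_Ioi
  have i2 := (integrableOn_exp_mul_complex_Iic hre2 0).congr_fun e2 measurableSet_Iic
  refine ⟨?_, ?_⟩
  · rw [← integrableOn_univ, ← Set.Iic_union_Ioi (a := (0 : ℝ))]
    exact i2.union i1
  · rw [← intervalIntegral.integral_Iic_add_Ioi i2 i1, ← setIntegral_congr_fun measurableSet_Ioi e1,
      ← setIntegral_congr_fun measurableSet_Iic e2, integral_exp_mul_complex_Ioi hre1,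
      integral_exp_mul_complex_Iic hre2]
    have h1 : (Complex.I * ξ - a : ℂ) ≠ 0 := fun h => by simp [h] at hre1
    have h2 : (Complex.I * ξ + a : ℂ) ≠ 0 := fun h => by simp [h] at hre2
    have h3 : ((a : ℂ) ^ 2 + ξ ^ 2) = -((Complex.I * ξ + a) * (Complex.I * ξ - a)) := by
      ring_nf
      rw [Complex.I_sq]
      ring
    have h4 : ((a : ℂ) ^ 2 + ξ ^ 2) ≠ 0 := by
      rw [h3]
      exact neg_ne_zero.2 (mul_ne_zero h2 h1)
    push_cast
    rw [eq_div_iff h4, h3]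
    simp only [mul_zero, Complex.exp_zero]
    field_simp
    ring

/-- Integrating against the majorant `e · e^{-|y|/Y}` of the indicator function of `(0, Y]`, whose
Fourier transform decays quadratically, bounds the mean square by a double sum over pairs of
frequencies that does not depend on `Y`. -/
lemma setIntegral_norm_sq_expSum_le {ι : Type*} (s : Finset ι) (r : ι → ℂ) (lam : ι → ℝ)
    {Y : ℝ} (hY : 1 ≤ Y) :
    ∫ y in Set.Ioc 0 Y, ‖∑ n ∈ s, r n * Complex.exp (Complex.I * (lam n : ℂ) * (y : ℂ))‖ ^ 2 ≤
      2 * Real.exp 1 * Y * ∑ m ∈ s, ∑ n ∈ s, ‖r m‖ * ‖r n‖ * (1 + (lam m - lam n) ^ 2)⁻¹ := by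
  have hY0 : 0 < Y := one_pos.trans_le hY
  set a : ℝ := Y⁻¹ with ha
  have ha0 : 0 < a := inv_pos.2 hY0
  set S : ℝ → ℂ := fun y => ∑ n ∈ s, r n * Complex.exp (Complex.I * (lam n : ℂ) * (y : ℂ)) with hS
  have hScont : Continuous S := by fun_prop
  have hexpand (y : ℝ) : ((Real.exp (-(a * |y|)) * ‖S y‖ ^ 2 : ℝ) : ℂ) =
      ∑ m ∈ s, ∑ n ∈ s, r m * (starRingEnd ℂ) (r n) *
        Complex.exp (Complex.I * ((lam m - lam n : ℝ) : ℂ) * y - a * (|y| : ℝ)) := by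
    rw [Complex.ofReal_mul, Complex.ofReal_pow, ← Complex.mul_conj', hS]
    simp only [map_sum, map_mul, ← Complex.exp_conj, Complex.conj_I, Complex.conj_ofReal]
    rw [Finset.sum_mul_sum, Finset.mul_sum]
    refine Finset.sum_congr rfl fun m _ => ?_
    rw [Finset.mul_sum]
    refine Finset.sum_congr rfl fun n _ => ?_
    rw [show Complex.I * ((lam m - lam n : ℝ) : ℂ) * y - a * (|y| : ℝ) =
      ((-(a * |y|) : ℝ) : ℂ) + (Complex.I * lam m * y + -Complex.I * lam n * y) by
        push_cast; ring, Complex.exp_add, Complex.exp_add, Complex.ofReal_exp]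
    ring
  have hint2 (m n : ι) : Integrable (fun y : ℝ => r m * (starRingEnd ℂ) (r n) *
      Complex.exp (Complex.I * ((lam m - lam n : ℝ) : ℂ) * y - a * (|y| : ℝ))) :=
    (integrable_exp_sub_mul_abs ha0 _).1.const_mul _
  have hintC : Integrable (fun y : ℝ => ((Real.exp (-(a * |y|)) * ‖S y‖ ^ 2 : ℝ) : ℂ)) := by
    simp_rw [hexpand]
    exact integrable_finsetSum _ fun m _ => integrable_finsetSum _ fun n _ => hint2 m n
  have hint : Integrable (fun y : ℝ => Real.exp (-(a * |y|)) * ‖S y‖ ^ 2) := by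
    simpa only [RCLike.re_to_complex, Complex.ofReal_re] using hintC.re
  have hval : ((∫ y : ℝ, Real.exp (-(a * |y|)) * ‖S y‖ ^ 2 : ℝ) : ℂ) =
      ∑ m ∈ s, ∑ n ∈ s, r m * (starRingEnd ℂ) (r n) *
        ((2 * a / (a ^ 2 + (lam m - lam n) ^ 2) : ℝ) : ℂ) := by
    rw [← integral_complex_ofReal]
    simp_rw [hexpand]
    rw [integral_finsetSum _ fun m _ => integrable_finsetSum _ fun n _ => hint2 m n]
    refine Finset.sum_congr rfl fun m _ => ?_
    rw [integral_finsetSum _ fun n _ => hint2 m n]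
    refine Finset.sum_congr rfl fun n _ => ?_
    rw [integral_const_mul, (integrable_exp_sub_mul_abs ha0 _).2]
  have hle : ∫ y in Set.Ioc 0 Y, ‖S y‖ ^ 2 ≤
      ∫ y in Set.Ioc 0 Y, Real.exp 1 * (Real.exp (-(a * |y|)) * ‖S y‖ ^ 2) := by
    refine setIntegral_mono_on (hScont.norm.pow 2).integrableOn_Ioc
      (hint.const_mul _).integrableOn measurableSet_Ioc fun y hy => ?_
    rw [← mul_assoc, ← Real.exp_add]
    refine le_mul_of_one_le_left (sq_nonneg _) (Real.one_le_exp ?_)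
    rw [abs_of_pos hy.1, ha, inv_mul_eq_div]
    linarith [(div_le_one hY0).2 hy.2]
  refine hle.trans ?_
  rw [integral_const_mul]
  have hfull : ∫ y in Set.Ioc 0 Y, Real.exp (-(a * |y|)) * ‖S y‖ ^ 2 ≤
      ∫ y : ℝ, Real.exp (-(a * |y|)) * ‖S y‖ ^ 2 :=
    setIntegral_le_integral hint (ae_of_all _ fun y => by positivity)
  have hnorm : ∫ y : ℝ, Real.exp (-(a * |y|)) * ‖S y‖ ^ 2 ≤
      ∑ m ∈ s, ∑ n ∈ s, ‖r m‖ * ‖r n‖ * (2 * a / (a ^ 2 + (lam m - lam n) ^ 2)) := by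
    refine (le_abs_self _).trans ?_
    rw [← Real.norm_eq_abs, ← Complex.norm_real, hval]
    refine (norm_sum_le _ _).trans (Finset.sum_le_sum fun m _ => (norm_sum_le _ _).trans
      (Finset.sum_le_sum fun n _ => ?_))
    rw [norm_mul, norm_mul, RCLike.norm_conj, Complex.norm_real,
      Real.norm_of_nonneg (by positivity)]
  have hker (ξ : ℝ) : 2 * a / (a ^ 2 + ξ ^ 2) ≤ 2 * Y * (1 + ξ ^ 2)⁻¹ := by
    have h1 : 2 * a / (a ^ 2 + ξ ^ 2) = 2 * Y / (1 + Y ^ 2 * ξ ^ 2) := by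
      rw [ha]
      field_simp
    rw [h1, ← div_eq_mul_inv]
    gcongr
    nlinarith [sq_nonneg ξ, mul_nonneg (sub_nonneg.2 (one_le_pow₀ hY (n := 2))) (sq_nonneg ξ)]
  calc Real.exp 1 * ∫ y in Set.Ioc 0 Y, Real.exp (-(a * |y|)) * ‖S y‖ ^ 2
      ≤ Real.exp 1 * ∑ m ∈ s, ∑ n ∈ s,
          ‖r m‖ * ‖r n‖ * (2 * Y * (1 + (lam m - lam n) ^ 2)⁻¹) := by
        gcongr
        refine hfull.trans (hnorm.trans ?_)
        gcongr with m _ n _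
        exact hker _
    _ = _ := by
        simp only [Finset.mul_sum]
        refine Finset.sum_congr rfl fun m _ => Finset.sum_congr rfl fun n _ => ?_
        ring

lemma summable_inv_one_add_int_sq : Summable (fun z : ℤ => (1 + (z : ℝ) ^ 2)⁻¹) := by
  refine Summable.of_nonneg_of_le (fun z => by positivity) (fun z => ?_)
    ((Real.summable_one_div_int_pow (p := 2)).2 one_lt_two |>.add
      (summable_of_ne_finset_zero (s := {0}) (f := fun z : ℤ => if z = 0 then (1 : ℝ) else 0)
        fun z hz => by simpa using hz))
  by_cases hz : z = 0
  · simp [hz]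
  · simp only [hz, if_false, add_zero, one_div]
    have : (0 : ℝ) < (z : ℝ) ^ 2 := by positivity
    gcongr
    linarith

/-- Schur's test for the kernel `1 / (1 + (i - j)²)` on the integers. -/
lemma sum_sum_mul_inv_one_add_sq_le (J : Finset ℕ) (A : ℕ → ℝ) :
    ∑ i ∈ J, ∑ j ∈ J, A i * A j * (1 + ((i : ℝ) - j) ^ 2)⁻¹ ≤
      (∑' z : ℤ, (1 + (z : ℝ) ^ 2)⁻¹) * ∑ j ∈ J, A j ^ 2 := by
  set W : ℝ := ∑' z : ℤ, (1 + (z : ℝ) ^ 2)⁻¹ with hW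
  have hrow (i : ℕ) : ∑ j ∈ J, (1 + ((i : ℝ) - j) ^ 2)⁻¹ ≤ W := by
    have hinj : Set.InjOn (fun j : ℕ => (i : ℤ) - j) J := fun a _ b _ hab => by
      simpa using hab
    have := summable_inv_one_add_int_sq.sum_le_tsum (J.image fun j : ℕ => (i : ℤ) - j)
      (fun z _ => by positivity)
    rw [Finset.sum_image hinj] at this
    simpa using this
  have hsymm : ∑ i ∈ J, ∑ j ∈ J, A j ^ 2 * (1 + ((i : ℝ) - j) ^ 2)⁻¹ =
      ∑ i ∈ J, ∑ j ∈ J, A i ^ 2 * (1 + ((i : ℝ) - j) ^ 2)⁻¹ := by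
    rw [Finset.sum_comm]
    refine Finset.sum_congr rfl fun i _ => Finset.sum_congr rfl fun j _ => ?_
    rw [← neg_sub, neg_sq]
  calc ∑ i ∈ J, ∑ j ∈ J, A i * A j * (1 + ((i : ℝ) - j) ^ 2)⁻¹
      ≤ ∑ i ∈ J, ∑ j ∈ J, (A i ^ 2 * (1 + ((i : ℝ) - j) ^ 2)⁻¹ / 2 +
          A j ^ 2 * (1 + ((i : ℝ) - j) ^ 2)⁻¹ / 2) := by
        gcongr with i _ j _
        rw [← add_div, ← add_mul, mul_div_right_comm]
        gcongr
        nlinarith [sq_nonneg (A i - A j)]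
    _ = ∑ i ∈ J, ∑ j ∈ J, A i ^ 2 * (1 + ((i : ℝ) - j) ^ 2)⁻¹ := by
        simp only [Finset.sum_add_distrib, ← Finset.sum_div, hsymm]
        ring
    _ ≤ ∑ i ∈ J, A i ^ 2 * W := by
        simp only [← Finset.mul_sum]
        gcongr with i _
        exact hrow i
    _ = W * ∑ j ∈ J, A j ^ 2 := by rw [← Finset.sum_mul, mul_comm]

lemma finite_setOf_le {lam : ℕ → ℝ} (h : Tendsto lam atTop atTop) (X : ℝ) :
    {n | lam n ≤ X}.Finite := by
  have := (h.eventually_gt_atTop X)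
  rw [← Nat.cofinite_eq_atTop, eventually_cofinite] at this
  simpa using this

lemma coeffSum_eq_sum {lam : ℕ → ℝ} (h : Tendsto lam atTop atTop) (r : ℕ → ℂ) (S T : ℝ) :
    coeffSum lam r S T = ∑ n ∈ (finite_setOf_le h T).toFinset with S < lam n, ‖r n‖ := by
  rw [coeffSum]
  refine finsum_mem_eq_sum_of_inter_support_eq (s := {n | S < lam n ∧ lam n ≤ T}) _ ?_
  ext n
  simp [and_comm]

lemma sum_norm_le_coeffSum {lam : ℕ → ℝ} (h : Tendsto lam atTop atTop) (r : ℕ → ℂ) {S T : ℝ}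
    (s : Finset ℕ) (hs : ∀ n ∈ s, S < lam n ∧ lam n ≤ T) :
    ∑ n ∈ s, ‖r n‖ ≤ coeffSum lam r S T := by
  rw [coeffSum_eq_sum h]
  refine Finset.sum_le_sum_of_subset_of_nonneg (fun n hn => ?_) fun _ _ _ => norm_nonneg _
  simpa [and_comm] using hs n hn

lemma coeffSum_nonneg {lam : ℕ → ℝ} (h : Tendsto lam atTop atTop) (r : ℕ → ℂ) (S T : ℝ) :
    0 ≤ coeffSum lam r S T := by
  rw [coeffSum_eq_sum h]
  exact Finset.sum_nonneg fun _ _ => norm_nonneg _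

/-- A large sieve inequality: the mean square of an exponential sum with frequencies beyond `N`,
over any interval `(0, Y]` with `Y ≥ 1`, is controlled by the `ℓ²`-norm of the sums of `|r_n|` over
unit intervals. -/
lemma setIntegral_norm_sq_expSum_le_tsum {lam : ℕ → ℝ} (hpos : ∀ n, 0 < lam n)
    (h : Tendsto lam atTop atTop) (r : ℕ → ℂ)
    (hsum : Summable fun j : ℕ => coeffSum lam r j (j + 1) ^ 2) :
    ∃ C : ℝ, 0 ≤ C ∧ ∀ (N : ℕ) (s : Finset ℕ), (∀ n ∈ s, (N : ℝ) < lam n) → ∀ Y : ℝ, 1 ≤ Y →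
      ∫ y in Set.Ioc 0 Y,
        ‖∑ n ∈ s, r n * Complex.exp (Complex.I * (lam n : ℂ) * (y : ℂ))‖ ^ 2 ≤
      C * Y * ∑' j : ℕ, coeffSum lam r ((j + N : ℕ) : ℝ) ((j + N : ℕ) + 1) ^ 2 := by
  set W : ℝ := ∑' z : ℤ, (1 + (z : ℝ) ^ 2)⁻¹ with hW
  have hW0 : 0 ≤ W := tsum_nonneg fun z => by positivity
  refine ⟨2 * Real.exp 1 * (3 * W), by positivity, fun N s hs Y hY => ?_⟩
  -- The half-open unit interval `(k n, k n + 1]` contains `lam n`.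
  set k : ℕ → ℕ := fun n => ⌈lam n⌉₊ - 1 with hk
  have hk1 (n : ℕ) : k n + 1 = ⌈lam n⌉₊ := Nat.succ_pred_eq_of_pos (Nat.ceil_pos.2 (hpos n))
  have hklt (n : ℕ) : (k n : ℝ) < lam n := Nat.lt_ceil.1 (by rw [← hk1 n]; exact Nat.lt_succ_self _)
  have hkle (n : ℕ) : lam n ≤ k n + 1 := by
    have := Nat.le_ceil (lam n)
    rw [← hk1 n] at this
    exact_mod_cast this
  set J : Finset ℕ := s.image k with hJ
  set A : ℕ → ℝ := fun j => ∑ n ∈ s with k n = j, ‖r n‖ with hA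
  have hmaps : ∀ n ∈ s, k n ∈ J := fun n hn => Finset.mem_image_of_mem k hn
  have hA0 (j : ℕ) : 0 ≤ A j := Finset.sum_nonneg fun _ _ => norm_nonneg _
  have hAle (j : ℕ) : A j ≤ coeffSum lam r j (j + 1) := by
    refine sum_norm_le_coeffSum h r _ fun n hn => ?_
    obtain rfl := (Finset.mem_filter.1 hn).2
    exact ⟨hklt n, hkle n⟩
  -- Rounding changes the difference of two frequencies by at most `1`.
  have hker (m n : ℕ) :
      (1 + (lam m - lam n) ^ 2)⁻¹ ≤ 3 * (1 + ((k m : ℝ) - k n) ^ 2)⁻¹ := by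
    have h1 := hklt m
    have h2 := hkle m
    have h3 := hklt n
    have h4 := hkle n
    have h5 : |((k m : ℝ) - k n) - (lam m - lam n)| ≤ 1 := by
      rw [abs_le]
      constructor <;> linarith
    have h6 : (((k m : ℝ) - k n) - (lam m - lam n)) ^ 2 ≤ 1 := (sq_le_one_iff_abs_le_one _).2 h5
    rw [← div_eq_mul_inv, le_div_iff₀ (by positivity), inv_mul_le_iff₀ (by positivity)]
    nlinarith [sq_nonneg (((k m : ℝ) - k n) - 2 * (lam m - lam n))]
  have hgroup : ∑ m ∈ s, ∑ n ∈ s, ‖r m‖ * ‖r n‖ * (1 + ((k m : ℝ) - k n) ^ 2)⁻¹ =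
      ∑ i ∈ J, ∑ j ∈ J, A i * A j * (1 + ((i : ℝ) - j) ^ 2)⁻¹ := by
    rw [← Finset.sum_fiberwise_of_maps_to hmaps]
    refine Finset.sum_congr rfl fun i _ => ?_
    have : ∀ m ∈ s.filter (fun n => k n = i),
        ∑ n ∈ s, ‖r m‖ * ‖r n‖ * (1 + ((k m : ℝ) - k n) ^ 2)⁻¹ =
        ∑ j ∈ J, ‖r m‖ * (A j * (1 + ((i : ℝ) - j) ^ 2)⁻¹) := by
      intro m hm
      rw [← Finset.sum_fiberwise_of_maps_to hmaps, (Finset.mem_filter.1 hm).2]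
      refine Finset.sum_congr rfl fun j _ => ?_
      rw [hA, Finset.sum_mul, Finset.mul_sum]
      refine Finset.sum_congr rfl fun n hn => ?_
      rw [(Finset.mem_filter.1 hn).2, mul_assoc]
    rw [Finset.sum_congr rfl this, Finset.sum_comm]
    refine Finset.sum_congr rfl fun j _ => ?_
    rw [← Finset.sum_mul, mul_assoc]
  have htail : ∑ j ∈ J, A j ^ 2 ≤
      ∑' j : ℕ, coeffSum lam r ((j + N : ℕ) : ℝ) ((j + N : ℕ) + 1) ^ 2 := by
    have hdisj : Disjoint J (Finset.range N) := by
      rw [Finset.disjoint_left]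
      intro j hj hjN
      obtain ⟨n, hn, rfl⟩ := Finset.mem_image.1 hj
      have h1 : ((k n + 1 : ℕ) : ℝ) ≤ N := by exact_mod_cast Finset.mem_range.1 hjN
      have h2 := hs n hn
      have h3 := hkle n
      push_cast at h1
      linarith
    have h1 := hsum.sum_le_tsum (J ∪ Finset.range N) fun j _ => sq_nonneg _
    rw [Finset.sum_union hdisj, ← hsum.sum_add_tsum_nat_add N] at h1
    refine (Finset.sum_le_sum fun j _ => pow_le_pow_left₀ (hA0 j) (hAle j) 2).trans ?_
    linarith
  have hpairs : ∑ m ∈ s, ∑ n ∈ s, ‖r m‖ * ‖r n‖ * (1 + (lam m - lam n) ^ 2)⁻¹ ≤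
      3 * (W * ∑ j ∈ J, A j ^ 2) := by
    calc _ ≤ ∑ m ∈ s, ∑ n ∈ s, ‖r m‖ * ‖r n‖ * (3 * (1 + ((k m : ℝ) - k n) ^ 2)⁻¹) := by
          gcongr with m _ n _
          exact hker m n
      _ = 3 * ∑ m ∈ s, ∑ n ∈ s, ‖r m‖ * ‖r n‖ * (1 + ((k m : ℝ) - k n) ^ 2)⁻¹ := by
          simp only [Finset.mul_sum]
          refine Finset.sum_congr rfl fun m _ => Finset.sum_congr rfl fun n _ => ?_
          ring
      _ ≤ _ := by
          rw [hgroup]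
          gcongr
          exact sum_sum_mul_inv_one_add_sq_le J A
  refine (setIntegral_norm_sq_expSum_le s r lam hY).trans ?_
  calc _ ≤ 2 * Real.exp 1 * Y * (3 * (W *
        ∑' j : ℕ, coeffSum lam r ((j + N : ℕ) : ℝ) ((j + N : ℕ) + 1) ^ 2)) := by
        refine mul_le_mul_of_nonneg_left (hpairs.trans ?_) (by positivity)
        gcongr
    _ = _ := by ring

/-! ### Square-summability of the coefficient sums over unit intervals -/

lemma coeffSum_add_coeffSum {lam : ℕ → ℝ} (h : Tendsto lam atTop atTop) (r : ℕ → ℂ) {S T U : ℝ}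
    (hST : S ≤ T) (hTU : T ≤ U) :
    coeffSum lam r S T + coeffSum lam r T U = coeffSum lam r S U := by
  have hset : {n | S < lam n ∧ lam n ≤ U} =
      {n | S < lam n ∧ lam n ≤ T} ∪ {n | T < lam n ∧ lam n ≤ U} := by
    ext n
    simp only [Set.mem_ofPred_eq, Set.mem_union]
    constructor
    · rintro ⟨h1, h2⟩
      rcases le_or_gt (lam n) T with h3 | h3
      · exact Or.inl ⟨h1, h3⟩
      · exact Or.inr ⟨h3, h2⟩
    · rintro (⟨h1, h2⟩ | ⟨h1, h2⟩)
      · exact ⟨h1, h2.trans hTU⟩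
      · exact ⟨hST.trans_lt h1, h2⟩
  have hdisj : Disjoint {n | S < lam n ∧ lam n ≤ T} {n | T < lam n ∧ lam n ≤ U} :=
    Set.disjoint_left.2 fun n h1 h2 => h1.2.not_gt h2.1
  have hU := finsum_mem_union (f := fun n => ‖r n‖) hdisj
    ((finite_setOf_le h T).subset fun n hn => hn.2) ((finite_setOf_le h U).subset fun n hn => hn.2)
  rw [← hset] at hU
  exact hU.symm

lemma sum_coeffSum_eq_coeffSum {lam : ℕ → ℝ} (h : Tendsto lam atTop atTop) (r : ℕ → ℂ) (a m : ℕ) :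
    ∑ j ∈ Finset.Ico a (a + m), coeffSum lam r j (j + 1) = coeffSum lam r a (a + m) := by
  induction m with
  | zero =>
    rw [coeffSum_eq_sum h, eq_comm]
    refine Eq.trans (Finset.sum_eq_zero fun n hn => ?_) (by simp)
    have := Finset.mem_filter.1 hn
    simp at this
    linarith
  | succ m ih =>
    rw [← add_assoc, Finset.sum_Ico_succ_top (by omega), ih]
    push_cast
    rw [coeffSum_add_coeffSum h r (by linarith) (by linarith), add_assoc]

lemma eventually_log_rpow_le (γ : ℝ) {δ : ℝ} (hδ : 0 < δ) :
    ∀ᶠ x : ℝ in atTop, Real.log x ^ γ ≤ x ^ δ := by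
  filter_upwards [(isLittleO_log_rpow_rpow_atTop γ hδ).bound one_pos, eventually_ge_atTop 0]
    with x hx hx0
  rw [one_mul, Real.norm_of_nonneg (Real.rpow_nonneg hx0 δ)] at hx
  exact (le_abs_self _).trans hx

lemma ShortIntervalBound.summable_sq {lam : ℕ → ℝ} (h : Tendsto lam atTop atTop) {r : ℕ → ℂ}
    {β γ : ℝ} (hβ : 1 / 2 < β) (hb : ShortIntervalBound lam r β γ) :
    Summable fun j : ℕ => coeffSum lam r j (j + 1) ^ 2 := by
  obtain ⟨C, T₀, hC⟩ := hb
  set δ : ℝ := (β - 1 / 2) / 2 with hδ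
  have hδ0 : 0 < δ := by linarith
  have hs : Summable fun j : ℕ => C ^ 2 * (j : ℝ) ^ (-β - 1 / 2) :=
    (Real.summable_nat_rpow.2 (by linarith)).mul_left _
  refine hs.of_norm_bounded_eventually_nat ?_
  have hcast : Tendsto (fun j : ℕ => (j : ℝ)) atTop atTop := tendsto_natCast_atTop_atTop
  filter_upwards [hcast.eventually (eventually_log_rpow_le γ hδ0),
    hcast.eventually_ge_atTop T₀, hcast.eventually_ge_atTop 1] with j hj hT hj1
  have hj0 : (0 : ℝ) < j := by linarith
  have h0 := coeffSum_nonneg h r j (j + 1)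
  have hlog : 0 ≤ Real.log j ^ γ := Real.rpow_nonneg (Real.log_nonneg hj1) γ
  have hB : coeffSum lam r j (j + 1) ≤ |C| * (j : ℝ) ^ (δ - β) := by
    refine (hC j hT).trans ?_
    rw [Real.rpow_sub hj0]
    refine mul_le_mul (le_abs_self C) ?_ (by positivity) (abs_nonneg C)
    gcongr
  rw [Real.norm_of_nonneg (sq_nonneg _)]
  calc coeffSum lam r j (j + 1) ^ 2 ≤ (|C| * (j : ℝ) ^ (δ - β)) ^ 2 := by gcongr
    _ = C ^ 2 * (j : ℝ) ^ (-β - 1 / 2) := by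
      rw [mul_pow, sq_abs, ← Real.rpow_mul_natCast hj0.le]
      congr 2
      rw [hδ]
      push_cast
      ring

lemma summable_of_summable_dyadic {f : ℕ → ℝ} (hf : ∀ n, 0 ≤ f n)
    (h : Summable fun i : ℕ => ∑ j ∈ Finset.Ico (2 ^ i) (2 ^ i + 2 ^ i), f j) : Summable f := by
  have hsum (n : ℕ) : ∑ j ∈ Finset.range (2 ^ n), f j =
      f 0 + ∑ i ∈ Finset.range n, ∑ j ∈ Finset.Ico (2 ^ i) (2 ^ i + 2 ^ i), f j := by
    induction n with
    | zero => simp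
    | succ n ih =>
      rw [Finset.sum_range_succ, ← add_assoc, ← ih, pow_succ, mul_two, Finset.range_eq_Ico,
        Finset.range_eq_Ico, Finset.sum_Ico_consecutive _ (Nat.zero_le _) (Nat.le_add_right _ _)]
  refine summable_of_sum_range_le (c := f 0 +
    ∑' i : ℕ, ∑ j ∈ Finset.Ico (2 ^ i) (2 ^ i + 2 ^ i), f j) hf fun n => ?_
  calc ∑ j ∈ Finset.range n, f j ≤ ∑ j ∈ Finset.range (2 ^ n), f j :=
        Finset.sum_le_sum_of_subset_of_nonneg
          (Finset.range_subset_range.2 Nat.lt_two_pow_self.le) fun j _ _ => hf j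
    _ ≤ _ := by
        rw [hsum]
        gcongr
        exact h.sum_le_tsum _ fun i _ => Finset.sum_nonneg fun j _ => hf j

/-- On a dyadic block `[S, 2S)` the sum of squares is at most the largest term, `≪ S^(δ - β)`,
times the full sum, `≪ S^(α + δ - β)`; these products are summable over `S = 2^i` as
`α < 2 β`. -/
lemma LongIntervalBound.summable_sq {lam : ℕ → ℝ} (h : Tendsto lam atTop atTop) {r : ℕ → ℂ}
    {α β γ : ℝ} (hβ : 0 < β) (hγ : 0 ≤ γ) (hαβ : α < 2 * β) (hb : LongIntervalBound lam r α β γ) :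
    Summable fun j : ℕ => coeffSum lam r j (j + 1) ^ 2 := by
  obtain ⟨C, S₀, hC⟩ := hb
  set δ : ℝ := (2 * β - α) / 4 with hδ
  have hδ0 : 0 < δ := by linarith
  refine summable_of_summable_dyadic (fun j => sq_nonneg _) ?_
  have hs : Summable fun i : ℕ =>
      C ^ 2 * ((2 : ℝ) ^ δ) ^ 2 * ((2 : ℝ) ^ (α + 2 * δ - 2 * β)) ^ i := by
    refine (summable_geometric_of_lt_one (by positivity) ?_).mul_left _
    exact Real.rpow_lt_one_of_one_lt_of_neg one_lt_two (by linarith)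
  refine hs.of_norm_bounded_eventually_nat ?_
  have hpow : Tendsto (fun i : ℕ => (2 : ℝ) ^ i) atTop atTop :=
    tendsto_pow_atTop_atTop_of_one_lt one_lt_two
  filter_upwards [(hpow.const_mul_atTop two_pos).eventually (eventually_log_rpow_le γ hδ0),
    hpow.eventually_ge_atTop S₀] with i hlog hS
  set S : ℝ := (2 : ℝ) ^ i with hSdef
  have hS1 : 1 ≤ S := one_le_pow₀ one_le_two
  have hS0 : 0 < S := one_pos.trans_le hS1
  set M : ℝ := |C| * ((2 * S) ^ δ / S ^ β) with hM
  have hM0 : 0 ≤ M := by positivity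
  have hterm : ∀ j ∈ Finset.Ico ((2 : ℕ) ^ i) (2 ^ i + 2 ^ i), coeffSum lam r j (j + 1) ≤ M := by
    intro j hj
    obtain ⟨h1, h2⟩ := Finset.mem_Ico.1 hj
    have h1' : S ≤ j := by rw [hSdef]; exact_mod_cast h1
    have h2' : (j : ℝ) + 1 ≤ 2 * S := by rw [hSdef, two_mul]; exact_mod_cast h2
    have hlog0 : 0 ≤ Real.log ((j : ℝ) + 1) := Real.log_nonneg (by linarith)
    refine (hC j (j + 1) (hS.trans h1') le_rfl).trans ?_
    rw [add_sub_cancel_left, Real.one_rpow, one_mul]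
    refine mul_le_mul (le_abs_self C) ?_ (by positivity) (abs_nonneg C)
    have : Real.log ((j : ℝ) + 1) ^ γ ≤ (2 * S) ^ δ := by
      refine le_trans ?_ hlog
      gcongr
    gcongr
  have htotal : ∑ j ∈ Finset.Ico ((2 : ℕ) ^ i) (2 ^ i + 2 ^ i), coeffSum lam r j (j + 1) ≤
      S ^ α * M := by
    rw [sum_coeffSum_eq_coeffSum h]
    push_cast
    refine (hC S (S + S) hS (by linarith)).trans ?_
    rw [add_sub_cancel_left, ← two_mul S, hM, mul_div_assoc, mul_left_comm (S ^ α)]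
    have hlog0 : 0 ≤ Real.log (2 * S) := Real.log_nonneg (by linarith)
    refine mul_le_mul (le_abs_self C) ?_ (by positivity) (abs_nonneg C)
    gcongr
  rw [Real.norm_of_nonneg (Finset.sum_nonneg fun j _ => sq_nonneg _)]
  calc ∑ j ∈ Finset.Ico ((2 : ℕ) ^ i) (2 ^ i + 2 ^ i), coeffSum lam r j (j + 1) ^ 2
      ≤ ∑ j ∈ Finset.Ico ((2 : ℕ) ^ i) (2 ^ i + 2 ^ i), M * coeffSum lam r j (j + 1) := by
        refine Finset.sum_le_sum fun j hj => ?_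
        rw [sq]
        exact mul_le_mul_of_nonneg_right (hterm j hj) (coeffSum_nonneg h r _ _)
    _ ≤ M * (S ^ α * M) := by
        rw [← Finset.mul_sum]
        gcongr
    _ = C ^ 2 * ((2 : ℝ) ^ δ) ^ 2 * S ^ (α + 2 * δ - 2 * β) := by
        rw [hM, Real.mul_rpow two_pos.le hS0.le, Real.rpow_sub hS0, Real.rpow_add hS0,
          mul_comm 2 δ, mul_comm 2 β, Real.rpow_mul hS0.le, Real.rpow_mul hS0.le, Real.rpow_two,
          Real.rpow_two, ← sq_abs C]
        field_simp
    _ = _ := by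
        rw [hSdef, ← Real.rpow_natCast_mul two_pos.le, mul_comm (i : ℝ),
          Real.rpow_mul_natCast two_pos.le]

/-! ### The almost periodicity criterion -/

lemma exponentialSum_eq_sum {lam : ℕ → ℝ} (h : Tendsto lam atTop atTop) (r : ℕ → ℂ) (X y : ℝ) :
    exponentialSum lam r X y = ∑ n ∈ (finite_setOf_le h X).toFinset,
      r n * Complex.exp (Complex.I * (lam n : ℂ) * (y : ℂ)) :=
  finsum_mem_eq_finite_toFinset_sum _ (finite_setOf_le h X)

lemma exponentialSum_sub {lam : ℕ → ℝ} (h : Tendsto lam atTop atTop) (r : ℕ → ℂ) {T X : ℝ}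
    (hTX : T ≤ X) (y : ℝ) :
    exponentialSum lam r X y - exponentialSum lam r T y =
      ∑ n ∈ (finite_setOf_le h X).toFinset with T < lam n,
        r n * Complex.exp (Complex.I * (lam n : ℂ) * (y : ℂ)) := by
  have hT : (finite_setOf_le h T).toFinset =
      (finite_setOf_le h X).toFinset.filter fun n => ¬ T < lam n := by
    ext n
    simp only [Set.Finite.mem_toFinset, Set.mem_ofPred_eq, Finset.mem_filter, not_lt]
    exact ⟨fun hn => ⟨hn.trans hTX, hn⟩, fun hn => hn.2⟩
  rw [exponentialSum_eq_sum h, exponentialSum_eq_sum h, hT, sub_eq_iff_eq_add,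
    Finset.sum_filter_add_sum_filter_not]

lemma isRealTrigPolynomial_const_add_re_exponentialSum {lam : ℕ → ℝ}
    (h : Tendsto lam atTop atTop) (r : ℕ → ℂ) (c X : ℝ) :
    IsRealTrigPolynomial (fun y => c + (exponentialSum lam r X y).re) := by
  simp_rw [exponentialSum_eq_sum h, Complex.re_sum]
  exact (IsRealTrigPolynomial.const c).add
    (IsRealTrigPolynomial.finset_sum _ fun n _ => IsRealTrigPolynomial.re_exp (r n) (lam n))

lemma memLp_two_Ioc_of_memLp_Ioc {φ : ℝ → ℝ} {a b c : ℝ} (hab : a ≤ b) (hbc : b ≤ c)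
    (h₁ : MemLp φ 2 (volume.restrict (Set.Ioc a b)))
    (h₂ : MemLp φ 2 (volume.restrict (Set.Ioc b c))) :
    MemLp φ 2 (volume.restrict (Set.Ioc a c)) := by
  have hm : AEStronglyMeasurable φ (volume.restrict (Set.Ioc a c)) := by
    rw [← Set.Ioc_union_Ioc_eq_Ioc hab hbc]
    exact aestronglyMeasurable_union_iff.2 ⟨h₁.1, h₂.1⟩
  rw [memLp_two_iff_integrable_sq hm, ← Set.Ioc_union_Ioc_eq_Ioc hab hbc]
  exact IntegrableOn.union h₁.integrable_sq h₂.integrable_sq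

/-- If the sums of `|r_n|` over unit intervals are square-summable, then the truncations of the
explicit formula approximate `φ` in mean square. -/
theorem isB2AlmostPeriodic_of_summable_sq {φ : ℝ → ℝ} {y₀ : ℝ} (hy₀ : 0 ≤ y₀)
    (hφ : MemLp φ 2 (volume.restrict (Set.Icc 0 y₀)))
    {lam : ℕ → ℝ} (hpos : ∀ n, 0 < lam n) (htop : Tendsto lam atTop atTop)
    {r : ℕ → ℂ} {c X₀ : ℝ} {E : ℝ → ℝ → ℝ}
    (hformula : ∀ y X : ℝ, y₀ ≤ y → X₀ ≤ X → φ y = c + (exponentialSum lam r X y).re + E y X)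
    (hE_sq : ∀ᶠ Y : ℝ in atTop,
      MemLp (fun y => E y (Real.exp Y)) 2 (volume.restrict (Set.Ioc y₀ Y)))
    (hE : Tendsto (fun Y : ℝ => Y⁻¹ * ∫ y in Set.Ioc y₀ Y, |E y (Real.exp Y)| ^ 2)
      atTop (𝓝 0))
    (hsum : Summable fun j : ℕ => coeffSum lam r j (j + 1) ^ 2) :
    IsB2AlmostPeriodic φ := by
  have hexp (X : ℝ) : ∀ᶠ Y in atTop, X ≤ Real.exp Y := Real.tendsto_exp_atTop.eventually_ge_atTop X
  have hφ0 : MemLp φ 2 (volume.restrict (Set.Ioc 0 y₀)) :=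
    hφ.mono_measure (Measure.restrict_mono Set.Ioc_subset_Icc_self le_rfl)
  have hmem : ∀ Y : ℝ, 0 < Y → MemLp φ 2 (volume.restrict (Set.Ioc 0 Y)) := by
    intro Y _
    obtain ⟨Z, hZ, hX, hYZ, hyZ⟩ := (hE_sq.and ((hexp X₀).and
      ((eventually_ge_atTop Y).and (eventually_ge_atTop y₀)))).exists
    have h2 : MemLp φ 2 (volume.restrict (Set.Ioc y₀ Z)) := by
      refine MemLp.ae_eq ?_ (((isRealTrigPolynomial_const_add_re_exponentialSum htop r c
        (Real.exp Z)).memLp).add hZ)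
      filter_upwards [ae_restrict_mem measurableSet_Ioc] with y hy
      exact (hformula y _ hy.1.le hX).symm
    exact (memLp_two_Ioc_of_memLp_Ioc hy₀ hyZ hφ0 h2).mono_measure
      (Measure.restrict_mono (Set.Ioc_subset_Ioc_right hYZ) le_rfl)
  refine ⟨hmem, fun ε hε => ?_⟩
  obtain ⟨C, hC0, hC⟩ := setIntegral_norm_sq_expSum_le_tsum hpos htop r hsum
  obtain ⟨N, hN⟩ : ∃ N : ℕ,
      2 * (C * ∑' j : ℕ, coeffSum lam r ((j + N : ℕ) : ℝ) ((j + N : ℕ) + 1) ^ 2) < ε ^ 2 / 2 := by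
    have h1 := ((tendsto_sum_nat_add fun j : ℕ => coeffSum lam r j (j + 1) ^ 2).const_mul
      C).const_mul 2
    rw [mul_zero, mul_zero] at h1
    exact (h1.eventually_lt_const (by positivity)).exists
  set τ : ℝ := ∑' j : ℕ, coeffSum lam r ((j + N : ℕ) : ℝ) ((j + N : ℕ) + 1) ^ 2 with hτ
  set P : ℝ → ℝ := fun y => c + (exponentialSum lam r N y).re with hP
  have hPtrig : IsRealTrigPolynomial P :=
    isRealTrigPolynomial_const_add_re_exponentialSum htop r c N
  refine ⟨P, hPtrig, ?_⟩
  have hD (Y : ℝ) (hY : 0 < Y) :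
      MemLp (fun y => φ y - P y) 2 (volume.restrict (Set.Ioc 0 Y)) :=
    (hmem Y hY).sub hPtrig.memLp
  set K : ℝ := ∫ y in Set.Ioc 0 y₀, (φ y - P y) ^ 2 with hK
  have hlim : Tendsto (fun Y : ℝ => Y⁻¹ * K + 2 * (C * τ) +
      2 * (Y⁻¹ * ∫ y in Set.Ioc y₀ Y, |E y (Real.exp Y)| ^ 2)) atTop (𝓝 (2 * (C * τ))) := by
    simpa using ((tendsto_inv_atTop_zero.mul_const K).add_const (2 * (C * τ))).add (hE.const_mul 2)
  have hbound : ∀ᶠ Y : ℝ in atTop, meanValue (fun y => (φ y - P y) ^ 2) Y ≤ ε ^ 2 / 2 := by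
    filter_upwards [hlim.eventually_lt_const hN, hE_sq, hexp X₀, hexp N, eventually_ge_atTop y₀,
      eventually_ge_atTop 1] with Y hlt hEY hX hNY hyY hY1
    refine le_trans ?_ hlt.le
    have hY0 : 0 < Y := one_pos.trans_le hY1
    set s : Finset ℕ := {n ∈ (finite_setOf_le htop (Real.exp Y)).toFinset | (N : ℝ) < lam n} with hs
    set S : ℝ → ℂ := fun y => ∑ n ∈ s, r n * Complex.exp (Complex.I * (lam n : ℂ) * (y : ℂ)) with hS
    have hScont : Continuous fun y => ‖S y‖ ^ 2 := by fun_prop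
    have hSmean : ∫ y in Set.Ioc 0 Y, ‖S y‖ ^ 2 ≤ C * Y * τ :=
      hC N s (fun n hn => (Finset.mem_filter.1 hn).2) Y hY1
    have hE2 : IntegrableOn (fun y => |E y (Real.exp Y)| ^ 2) (Set.Ioc y₀ Y) := by
      simpa only [sq_abs] using! hEY.integrable_sq
    have hsq := (hD Y hY0).integrable_sq
    have hsub : Set.Ioc y₀ Y ⊆ Set.Ioc 0 Y := Set.Ioc_subset_Ioc_left hy₀
    have hpt : ∀ y ∈ Set.Ioc y₀ Y,
        (φ y - P y) ^ 2 ≤ 2 * ‖S y‖ ^ 2 + 2 * |E y (Real.exp Y)| ^ 2 := by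
      intro y hy
      have h1 : φ y - P y = (S y).re + E y (Real.exp Y) := by
        have hSy : S y = exponentialSum lam r (Real.exp Y) y - exponentialSum lam r N y :=
          (exponentialSum_sub htop r hNY y).symm
        rw [hformula y _ hy.1.le hX, hSy, Complex.sub_re]
        ring
      have h2 : (S y).re ^ 2 ≤ ‖S y‖ ^ 2 := by
        rw [← sq_abs]
        gcongr
        exact Complex.abs_re_le_norm _
      rw [h1, sq_abs]
      nlinarith [sq_nonneg ((S y).re - E y (Real.exp Y))]
    have hsplit : ∫ y in Set.Ioc 0 Y, (φ y - P y) ^ 2 =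
        K + ∫ y in Set.Ioc y₀ Y, (φ y - P y) ^ 2 := by
      rw [← Set.Ioc_union_Ioc_eq_Ioc hy₀ hyY, setIntegral_union (Set.Ioc_disjoint_Ioc_of_le le_rfl)
        measurableSet_Ioc (hsq.mono_measure (Measure.restrict_mono
          (Set.Ioc_subset_Ioc_right hyY) le_rfl)) (IntegrableOn.mono_set hsq hsub)]
    have hScont2 : IntegrableOn (fun y => 2 * ‖S y‖ ^ 2) (Set.Ioc y₀ Y) :=
      (hScont.const_mul 2).integrableOn_Ioc
    have hright : ∫ y in Set.Ioc y₀ Y, (φ y - P y) ^ 2 ≤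
        2 * (C * Y * τ) + 2 * ∫ y in Set.Ioc y₀ Y, |E y (Real.exp Y)| ^ 2 := by
      calc ∫ y in Set.Ioc y₀ Y, (φ y - P y) ^ 2
          ≤ ∫ y in Set.Ioc y₀ Y, (2 * ‖S y‖ ^ 2 + 2 * |E y (Real.exp Y)| ^ 2) :=
            setIntegral_mono_on (IntegrableOn.mono_set hsq hsub)
              (hScont2.add (hE2.const_mul 2)) measurableSet_Ioc hpt
        _ = 2 * (∫ y in Set.Ioc y₀ Y, ‖S y‖ ^ 2) +
              2 * ∫ y in Set.Ioc y₀ Y, |E y (Real.exp Y)| ^ 2 := by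
            rw [integral_add hScont2 (hE2.const_mul 2), integral_const_mul, integral_const_mul]
        _ ≤ _ := by
            gcongr
            refine le_trans ?_ hSmean
            exact setIntegral_mono_set hScont.integrableOn_Ioc
              (ae_of_all _ fun y => sq_nonneg _) hsub.eventuallyLE
    calc meanValue (fun y => (φ y - P y) ^ 2) Y
        ≤ Y⁻¹ * (K + (2 * (C * Y * τ) + 2 * ∫ y in Set.Ioc y₀ Y, |E y (Real.exp Y)| ^ 2)) := by
          rw [meanValue, hsplit]
          gcongr
      _ = _ := by
          field_simp
          ring
  have hlimsup : upperMeanSquare (fun y => φ y - P y) ≤ ENNReal.ofReal (ε ^ 2 / 2) := by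
    refine limsup_le_of_le (by isBoundedDefault) ?_
    filter_upwards [hbound, eventually_gt_atTop 0] with Y hY hY0
    rw [mean_lintegral_eq_ofReal_meanValue (g := fun y => φ y - P y) hY0 (hD Y hY0)]
    exact ENNReal.ofReal_le_ofReal hY
  exact hlimsup.trans_lt ((ENNReal.ofReal_lt_ofReal_iff (by positivity)).2
    (half_lt_self (by positivity)))

theorem mainTheorem1
    -- the function `φ` on `[0, ∞)`, square-integrable on `[0, y₀]`
    (φ : ℝ → ℝ) (y₀ : ℝ) (hy₀ : 0 ≤ y₀)
    (hφ : MemLp φ 2 (volume.restrict (Set.Icc 0 y₀)))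
    -- exponents, coefficients, and the explicit formula with error term `E`
    (lam : ℕ → ℝ) (hlam_mono : Monotone lam) (hlam_pos : ∀ n, 0 < lam n)
    (hlam_top : Tendsto lam atTop atTop)
    (r : ℕ → ℂ) (c X₀ : ℝ) (hX₀ : 0 < X₀) (E : ℝ → ℝ → ℝ)
    (hformula : ∀ y X : ℝ, y₀ ≤ y → X₀ ≤ X →
      φ y = c + (exponentialSum lam r X y).re + E y X)
    -- the error term is square-integrable and has vanishing mean square
    (hE_sq : ∀ᶠ Y : ℝ in atTop,
      MemLp (fun y => E y (Real.exp Y)) 2 (volume.restrict (Set.Ioc y₀ Y)))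
    (hE : Tendsto (fun Y : ℝ => Y⁻¹ * ∫ y in Set.Ioc y₀ Y, |E y (Real.exp Y)| ^ 2)
      atTop (𝓝 0))
    -- either of the two conditions on the coefficients
    (α β γ : ℝ) (hα : 0 < α) (hβ : 0 < β) (hγ : 0 ≤ γ)
    (hcond : (1 / 2 < β ∧ ShortIntervalBound lam r β γ) ∨
      (β ≤ min 1 α ∧ α ^ 2 + α / 2 < β ^ 2 + β ∧ LongIntervalBound lam r α β γ)) :
    IsB2AlmostPeriodic φ ∧ ∃ μ : Measure ℝ, HasLimitingDistribution φ μ := by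
  have hsum : Summable fun j : ℕ => coeffSum lam r j (j + 1) ^ 2 := by
    rcases hcond with ⟨hβ', hb⟩ | ⟨-, hαβ, hb⟩
    · exact hb.summable_sq hlam_top hβ'
    · refine hb.summable_sq hlam_top hβ hγ ?_
      -- `2β ≤ α` would give `β² + β ≤ 4β² + β ≤ α² + α / 2`.
      by_contra! hα'
      nlinarith [mul_self_le_mul_self (by positivity) hα', sq_nonneg β]
  have hap := isB2AlmostPeriodic_of_summable_sq hy₀ hφ hlam_pos hlam_top hformula hE_sq hE hsum
  exact ⟨hap, hap.exists_hasLimitingDistribution⟩
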